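/- Let $A$ and $B$ be complex unital Banach algebras, and let $A\overline{\otimes}B$ be a Banach algebra that is the completion of the algebraic tensor product $A\otimes B$ with respect to a (submultiplicative) uniform crossnorm, i.e. a norm with $\|x\otimes y\|=\|x\|\,\|y\|$ for $x\in A$, $y\in B$ and $\|(S\otimes T)u\|\le\|S\|\,\|T\|\,\|u\|$ for all bounded linear operators $S$ on $A$, $T$ on $B$ and all $u\in A\otimes B$. An element $c$ of a unital Banach algebra $C$ is Drazin invertible if there are $d\in C$ and an integer $m\ge 0$ with $c^m d c=c^m$, $dcd=d$, $cd=dc$. Put $\sigma_{DR}(c)=\{\lambda\in\mathbb{C}: c-\lambda \text{ is not Drazin invertible}\}$ and $\rho_{DR}(c)=\mathbb{C}\setminus\sigma_{DR}(c)$; let $\sigma(c)$ be the spectrum of $c$, and let $\Pi(c)$ be the set of poles of $c$, that is, the set of isolated points of $\sigma(c)$ at which the resolvent function $\lambda\mapsto(\lambda-c)^{-1}$ has a pole (of some order $p\ge 1$). Let $a\in A$, $b\in B$ and $\mathbb{D}=\sigma(a)\,\sigma_{DR}(b)\cup\sigma_{DR}(a)\,\sigma(b)$, where a product of sets is the set of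 all products of their elements. (i) If $\sigma(a)=\Pi(a)\neq\{0\}$ and $\sigma_{DR}(b)\neq\emptyset$, then $\sigma_{DR}(a\otimes b)=\mathbb{D}$ if and only if $0\notin\Pi(a)$ or $0\notin\rho_{DR}(b)$. (ii) If $\sigma_{DR}(a)\neq\emptyset$ and $\sigma(b)=\Pi(b)\neq\{0\}$, then $\sigma_{DR}(a\otimes b)=\mathbb{D}$ if and only if $0\notin\rho_{DR}(a)$ or $0\notin\Pi(b)$. -/

import Mathlib

open scoped TensorProduct Pointwise Topology

noncomputable section

/-- `a` is Drazin invertible: there are `b` and `m` with `aᵐba = aᵐ`, `bab = b` and `ab = ba`. -/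
def IsDrazinInvertible {R : Type*} [Ring R] (a : R) : Prop :=
  ∃ (b : R) (m : ℕ), a ^ m * b * a = a ^ m ∧ b * a * b = b ∧ a * b = b * a

/-- The Drazin spectrum `σ_DR(a)`. -/
def drazinSpectrum {A : Type*} [Ring A] [Algebra ℂ A] (a : A) : Set ℂ :=
  {z | ¬ IsDrazinInvertible (a - algebraMap ℂ A z)}

/-- The Drazin resolvent set `ρ_DR(a)`. -/
def drazinResolventSet {A : Type*} [Ring A] [Algebra ℂ A] (a : A) : Set ℂ :=
  {z | IsDrazinInvertible (a - algebraMap ℂ A z)}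

/-- The isolated points of a set of complex numbers. -/
def isoPoints (K : Set ℂ) : Set ℂ := K \ derivedSet K

/-- The set `Π(a)` of poles of the resolvent of `a`: the isolated points of the spectrum at which
the resolvent function `z ↦ (z - a)⁻¹` has a pole of some order `p ≥ 1`, that is, is meromorphic
of order `-p`. -/
def poles {A : Type*} [NormedRing A] [NormedAlgebra ℂ A] (a : A) : Set ℂ :=
  {z | z ∈ isoPoints (spectrum ℂ a) ∧ MeromorphicAt (resolvent a : ℂ → A) z ∧
    ∃ p : ℕ, 1 ≤ p ∧ meromorphicOrderAt (resolvent a : ℂ → A) z = ((-(p : ℤ) : ℤ) : WithTop ℤ)}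

/-- The set `𝔻 = σ(a) σ_DR(b) ∪ σ_DR(a) σ(b)`. -/
def drazinProductSet {A B : Type*} [Ring A] [Algebra ℂ A] [Ring B] [Algebra ℂ B]
    (a : A) (b : B) : Set ℂ :=
  spectrum ℂ a * drazinSpectrum b ∪ drazinSpectrum a * spectrum ℂ b

/-- A uniform crossnorm on the algebraic tensor product `A ⊗ B` of two normed algebras whose
completion is a Banach algebra: a submultiplicative norm on `A ⊗ B` (`AlgebraNorm`) with
`‖a ⊗ b‖ = ‖a‖ ‖b‖` and `‖(S ⊗ T) u‖ ≤ ‖S‖ ‖T‖ ‖u‖` for all bounded linear operators `S` on `A`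
and `T` on `B`. -/
structure UniformCrossnorm (A B : Type*) [NormedRing A] [NormedAlgebra ℂ A]
    [NormedRing B] [NormedAlgebra ℂ B] extends AlgebraNorm ℂ (A ⊗[ℂ] B) where
  /-- The crossnorm property. -/
  map_tmul' : ∀ (a : A) (b : B), toFun (a ⊗ₜ[ℂ] b) = ‖a‖ * ‖b‖
  /-- Uniformity. -/
  map_map_le' : ∀ (S : A →L[ℂ] A) (T : B →L[ℂ] B) (u : A ⊗[ℂ] B),
    toFun (TensorProduct.map (S : A →ₗ[ℂ] A) (T : B →ₗ[ℂ] B) u) ≤ ‖S‖ * ‖T‖ * toFun u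

namespace UniformCrossnorm

variable {A B : Type*} [NormedRing A] [NormedAlgebra ℂ A] [NormedRing B] [NormedAlgebra ℂ B]

/-- The algebra `A ⊗ B`, to be normed by `α`. -/
def AlgTensor (_α : UniformCrossnorm A B) : Type _ := A ⊗[ℂ] B

variable (α : UniformCrossnorm A B)

instance : Ring α.AlgTensor := inferInstanceAs (Ring (A ⊗[ℂ] B))

instance : Algebra ℂ α.AlgTensor := inferInstanceAs (Algebra ℂ (A ⊗[ℂ] B))

/-- `A ⊗ B` normed by `α`. -/
instance : NormedRing α.AlgTensor where
  __ : Ring α.AlgTensor := inferInstance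
  __ := AddGroupNorm.toNormedAddCommGroup α.toRingNorm.toAddGroupNorm
  norm_mul_le u v := α.mul_le' u v

instance : NormedAlgebra ℂ α.AlgTensor where
  __ : Algebra ℂ α.AlgTensor := inferInstance
  norm_smul_le z u := (α.smul' z u).le

/-- The identity map from `A ⊗ B` to `A ⊗ B` normed by `α`. -/
def ofTensor : A ⊗[ℂ] B ≃ₐ[ℂ] α.AlgTensor := AlgEquiv.refl

/-- The Banach algebra `A ⊗̄ B`: the completion of `A ⊗ B` with respect to `α`. -/
abbrev BanachTensor : Type _ := UniformSpace.Completion α.AlgTensor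

instance : NormedAlgebra ℂ α.BanachTensor where
  __ : Algebra ℂ α.BanachTensor := inferInstance
  norm_smul_le := norm_smul_le

/-- The elementary tensor `a ⊗ b` in `A ⊗̄ B`. -/
def tmul (a : A) (b : B) : α.BanachTensor :=
  (α.ofTensor (a ⊗ₜ[ℂ] b) : UniformSpace.Completion α.AlgTensor)

end UniformCrossnorm

end

/-! If `σ(a) = Π(a)`, compactness makes `σ(a)` finite, and `a` is algebraic: a polynomial `P`
cancelling all the poles makes `z ↦ (z - a)⁻¹ P(a)` extend to an entire function vanishing at
infinity, so `P(a) = 0` by Liouville. The Chinese remainder theorem then gives nonzero idempotents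
`e s`, `s ∈ σ(a)`, with sum `1` and `(a - s) * e s` nilpotent. Under `e s`, the element `a ⊗ b - z`
is `s • b - z` up to a commuting nilpotent, which Drazin invertibility does not see
(`IsDrazinInvertible.add_nilpotent`), and a slice map strips off `e s`
(`isDrazinInvertible_map_mul_map_iff`). Hence `σ_DR(a ⊗ b) = ⋃ σ_DR(s • b)` over `s ∈ σ(a)`, while
`σ_DR(a) = ∅` and `𝔻 = σ(a) σ_DR(b)`.

The term at `s ≠ 0` is `s σ_DR(b)`, but at `s = 0` it is `∅` instead of `{0}`. So the two sets can
differ only in the point `0`, and do so exactly when `0 ∈ σ(a)` and `0 ∉ σ_DR(b)`. Part (ii) is the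
same with the factors exchanged. -/

/-! ### Drazin invertibility in a ring -/

section Drazin

variable {R : Type*} [Ring R] {x y : R}

/-- The Drazin inverse is `x ^ m * w ^ (m + 1)`; a witness `w` thus need not satisfy `w * x * w =
w`. -/
theorem IsDrazinInvertible.of_pow_succ_mul_eq {w : R} {m : ℕ} (hc : Commute x w)
    (h : x ^ (m + 1) * w = x ^ m) : IsDrazinInvertible x := by
  have key : ∀ k, x ^ (m + k) * w ^ k = x ^ m := by
    intro k
    induction k with
    | zero => simp
    | succ k ih =>
      calc x ^ (m + (k + 1)) * w ^ (k + 1) = x ^ k * (x ^ (m + 1) * w) * w ^ k := by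
            rw [pow_succ' w, show m + (k + 1) = k + (m + 1) by ring, pow_add x k]
            simp only [mul_assoc]
        _ = x ^ m := by rw [h, ← pow_add, add_comm k m, ih]
  have hxw : ∀ i j, Commute (x ^ i) (w ^ j) := fun i j => hc.pow_pow i j
  have hdx : x ^ m * w ^ (m + 1) * x = x ^ (m + 1) * w ^ (m + 1) := by
    rw [mul_assoc, ← ((hc.pow_right (m + 1)).eq), ← mul_assoc, ← pow_succ]
  refine ⟨x ^ m * w ^ (m + 1), m, ?_, ?_, ?_⟩
  · rw [mul_assoc, hdx, ← mul_assoc, ← pow_add, key]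
  · rw [hdx, mul_assoc, ← mul_assoc (w ^ (m + 1)), ← (hxw m (m + 1)).eq, mul_assoc, ← mul_assoc,
      ← pow_add, show m + 1 + m = m + (m + 1) by ring, ← mul_assoc, key]
  · rw [hdx, ← mul_assoc, ← pow_succ']

/-- A Drazin inverse lies in the bicommutant. -/
theorem IsDrazinInvertible.exists_bicommutant (h : IsDrazinInvertible x) :
    ∃ (d : R) (N : ℕ), (∀ y, Commute x y → Commute d y) ∧ d * x * d = d ∧
      ∀ m, N ≤ m → x ^ (m + 1) * d = x ^ m := by
  obtain ⟨d, m, h1, h2, h3⟩ := h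
  have hxd : Commute x d := h3
  have hm : ∀ k, m ≤ k → x ^ (k + 1) * d = x ^ k := by
    intro k hk
    obtain ⟨j, rfl⟩ := Nat.exists_eq_add_of_le hk
    rw [mul_assoc, ← h3] at h1
    rw [show m + j + 1 = j + (m + 1) by ring, pow_add, pow_succ x m, mul_assoc, mul_assoc, h1,
      ← pow_add, add_comm]
  have hp : ∀ k, x * d = x ^ (k + 1) * d ^ (k + 1) := by
    intro k
    induction k with
    | zero => simp
    | succ k ih =>
      calc x * d = x * (d * x * d) := by rw [h2]
        _ = (x * d) * (x * d) := by simp only [mul_assoc]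
        _ = (x ^ (k + 1) * d ^ (k + 1)) * (x * d) := by rw [← ih]
        _ = x ^ (k + 1) * (d ^ (k + 1) * x) * d := by simp only [mul_assoc]
        _ = x ^ (k + 1) * (x * d ^ (k + 1)) * d := by rw [(hxd.pow_right (k + 1)).eq]
        _ = _ := by rw [pow_succ x (k + 1), pow_succ d (k + 1)]; simp only [mul_assoc]
  refine ⟨d, m, fun y hy => ?_, h2, hm⟩
  -- The idempotent `p = x * d` fixes `x ^ (m + 1)` and equals `x ^ (m + 1) * d ^ (m + 1)`. This
  -- gives `y * p = p * y * p = p * y`, and `d = d * p = p * d` passes commutation on to `d`.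
  have hxp : x ^ (m + 1) * (x * d) = x ^ (m + 1) := by
    rw [← mul_assoc, ← pow_succ, hm (m + 1) (Nat.le_succ m)]
  have hpx : (x * d) * x ^ (m + 1) = x ^ (m + 1) := by
    have : Commute (x * d) (x ^ (m + 1)) :=
      ((Commute.refl x).mul_left hxd.symm).pow_right _
    rw [this.eq, hxp]
  have hyx : Commute (x ^ (m + 1)) y := hy.pow_left _
  have hpd : x * d = d ^ (m + 1) * x ^ (m + 1) := by
    rw [hp m, (hxd.pow_pow _ _).eq]
  have e1 : y * (x * d) = (x * d) * y * (x * d) := by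
    calc y * (x * d) = y * (x ^ (m + 1) * d ^ (m + 1)) := by rw [← hp m]
      _ = (x ^ (m + 1)) * y * d ^ (m + 1) := by rw [← mul_assoc, hyx.eq]
      _ = (x * d) * x ^ (m + 1) * y * d ^ (m + 1) := by rw [hpx]
      _ = (x * d) * (x ^ (m + 1) * y) * d ^ (m + 1) := by simp only [mul_assoc]
      _ = (x * d) * y * (x ^ (m + 1) * d ^ (m + 1)) := by rw [hyx.eq]; simp only [mul_assoc]
      _ = _ := by rw [← hp m]
  have e2 : (x * d) * y = (x * d) * y * (x * d) := by
    calc (x * d) * y = d ^ (m + 1) * (x ^ (m + 1) * y) := by rw [hpd, mul_assoc]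
      _ = d ^ (m + 1) * (y * x ^ (m + 1)) := by rw [hyx.eq]
      _ = d ^ (m + 1) * (y * (x ^ (m + 1) * (x * d))) := by rw [hxp]
      _ = d ^ (m + 1) * (y * x ^ (m + 1)) * (x * d) := by simp only [mul_assoc]
      _ = (d ^ (m + 1) * x ^ (m + 1)) * y * (x * d) := by rw [← hyx.eq]; simp only [mul_assoc]
      _ = _ := by rw [← hpd]
  have hyp : y * (x * d) = (x * d) * y := e1.trans e2.symm
  have h2' : d * (x * d) = d := by rw [← mul_assoc, h2]
  have h2'' : (x * d) * d = d := by rw [h3, h2]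
  calc d * y = d * ((x * d) * y) := by rw [← mul_assoc, h2']
    _ = d * (y * x) * d := by rw [← hyp]; simp only [mul_assoc]
    _ = (d * x) * y * d := by rw [← hy.eq]; simp only [mul_assoc]
    _ = y * ((x * d) * d) := by rw [← h3, ← hyp]; simp only [mul_assoc]
    _ = y * d := by rw [h2'']

/-- With `p = x * d`, `x` is invertible under `p` and nilpotent under `1 - p`. By the bicommutant
property `y` commutes with `p`, so adding it preserves both halves. -/
theorem IsDrazinInvertible.add_nilpotent (h : IsDrazinInvertible x) (hy : IsNilpotent y)
    (hc : Commute x y) : IsDrazinInvertible (x + y) := by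
  obtain ⟨d, N, hd, hdxd, hN⟩ := h.exists_bicommutant
  have hdx : Commute d x := hd x (Commute.refl x)
  have hdy : Commute d y := hd y hc
  obtain ⟨p, hp⟩ : ∃ p, p = x * d := ⟨_, rfl⟩
  have hxp : Commute x p := hp ▸ (Commute.refl x).mul_right hdx.symm
  have hyp : Commute y p := hp ▸ hc.symm.mul_right hdy.symm
  have hdp : Commute d p := hp ▸ hdx.mul_right (Commute.refl d)
  have hpd : p * d = d := by rw [hp, ← hdx.eq, hdxd]
  have hpp : p * p = p := by
    calc p * p = x * (d * p) := by rw [← mul_assoc, ← hp]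
      _ = p := by rw [hdp.eq, hpd, ← hp]
  have hcp : ∀ z, Commute z p → Commute z (1 - p) := fun z hz => (Commute.one_right z).sub_right hz
  have hpq : p * (1 - p) = 0 := by rw [mul_sub, mul_one, hpp, sub_self]
  have hqp : (1 - p) * p = 0 := by rw [sub_mul, one_mul, hpp, sub_self]
  have hqq : (1 - p) * (1 - p) = 1 - p := by rw [sub_mul, one_mul, hpq, sub_zero]
  -- the nilpotent part
  have hn1 : IsNilpotent (x * (1 - p)) := by
    refine ⟨N + 1, ?_⟩
    rw [(hcp x hxp).mul_pow, pow_succ (1 - p)]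
    have : x ^ (N + 1) * (1 - p) = 0 := by
      rw [mul_sub, mul_one, hp, ← mul_assoc, ← pow_succ, hN (N + 1) (Nat.le_succ N), sub_self]
    rw [((Commute.refl (1 - p)).pow_left N).eq, ← mul_assoc, this, zero_mul]
  have hn2 : IsNilpotent ((x + y) * (1 - p)) := by
    rw [add_mul]
    refine Commute.isNilpotent_add ?_ hn1 ((hcp y hyp).isNilpotent_mul_right hy)
    exact (hc.mul_right (hcp x hxp)).mul_left
      ((hcp y hyp).symm.mul_right (Commute.refl _))
  -- the invertible part
  have hu1 : (x * p + (1 - p)) * (d + (1 - p)) = 1 := by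
    have e1 : x * p * d = p := by rw [mul_assoc, hpd, hp]
    have e2 : x * p * (1 - p) = 0 := by rw [mul_assoc, hpq, mul_zero]
    have e3 : (1 - p) * d = 0 := by rw [sub_mul, one_mul, hpd, sub_self]
    rw [add_mul, mul_add, mul_add, e1, e2, e3, hqq]; abel
  have hcu : Commute (x * p + (1 - p)) (d + (1 - p)) := by
    refine Commute.add_left (Commute.add_right ?_ ?_) (Commute.add_right ?_ ?_)
    · exact (hdx.mul_right hdp).symm
    · exact (hcp x hxp).mul_left (hcp p (Commute.refl p))
    · exact (hcp d hdp).symm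
    · exact Commute.refl _
  have hu : IsUnit (x * p + (1 - p)) := ⟨⟨_, _, hu1, hcu.eq ▸ hu1⟩, rfl⟩
  have hu2 : IsUnit ((x + y) * p + (1 - p)) := by
    rw [show (x + y) * p + (1 - p) = (x * p + (1 - p)) + y * p by rw [add_mul]; abel]
    have hcomm : Commute (x * p + (1 - p)) (y * p) := by
      refine Commute.add_left ?_ ?_
      · exact (hc.mul_right hxp).mul_left (hyp.symm.mul_right (Commute.refl p))
      · exact ((hcp y hyp).symm).mul_right (hcp p (Commute.refl p)).symm
    exact (hyp.isNilpotent_mul_right hy).isUnit_add_left_of_commute hu hcomm.symm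
  have hzp : Commute (x + y) p := hxp.add_left hyp
  obtain ⟨M, hM⟩ := hn2
  obtain ⟨u, hu⟩ := hu2
  have hzu : Commute (x + y) (u : R) := by
    rw [hu]
    exact ((Commute.refl _).mul_right hzp).add_right (hcp _ hzp)
  have hpu : Commute p (u : R) := by
    rw [hu]
    exact (hzp.symm.mul_right (Commute.refl p)).add_right (hcp p (Commute.refl p))
  have hzui : Commute (x + y) (↑u⁻¹ : R) := hzu.units_inv_right
  have hup : (u : R) * p = (x + y) * p := by rw [hu, add_mul, mul_assoc, hpp, hqp, add_zero]
  have hz0 : (x + y) ^ (M + 1) * (1 - p) = 0 := by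
    have : (x + y) ^ M * (1 - p) ^ (M + 1) = 0 := by
      rw [pow_succ, ← mul_assoc, ← (hcp _ hzp).mul_pow, hM, zero_mul]
    have hq : (1 - p) ^ (M + 1) = 1 - p := by
      have : IsIdempotentElem (1 - p) := hqq
      exact this.pow_succ_eq M
    rw [hq] at this
    rw [pow_succ', mul_assoc, this, mul_zero]
  refine IsDrazinInvertible.of_pow_succ_mul_eq (w := p * (↑u⁻¹ : R)) (m := M + 1)
    (hzp.mul_right hzui) ?_
  have hinv : (x + y) * (p * (↑u⁻¹ : R)) = p := by
    rw [← mul_assoc, ← hup, hpu.symm.eq, mul_assoc, Units.mul_inv, mul_one]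
  rw [pow_succ, mul_assoc, hinv]
  rw [mul_sub, mul_one, sub_eq_zero] at hz0
  exact hz0.symm

theorem IsDrazinInvertible.mul_idempotent {e : R} (h : IsDrazinInvertible x)
    (he : IsIdempotentElem e) (hc : Commute x e) : IsDrazinInvertible (x * e) := by
  obtain ⟨d, N, hd, -, hN⟩ := h.exists_bicommutant
  have hdx : Commute d x := hd x (Commute.refl x)
  have hde : Commute d e := hd e hc
  -- A positive exponent is needed for the powers of `e` to collapse to `e`.
  refine .of_pow_succ_mul_eq (w := d) (m := N + 1) (hdx.mul_right hde).symm ?_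
  rw [hc.mul_pow, hc.mul_pow, he.pow_succ_eq, he.pow_succ_eq, mul_assoc, ← hde.eq, ← mul_assoc,
    hN (N + 1) (Nat.le_succ N)]

/-- For large `k` the local equations read `x ^ (k + 1) * (e i * d i) = x ^ k * e i`; summing them
gives the witness `∑ e i * d i`, without orthogonality of the `e i`. -/
theorem isDrazinInvertible_of_forall_mul_idempotent {ι : Type*} (S : Finset ι) (e : ι → R)
    (hsum : ∑ i ∈ S, e i = 1) (he : ∀ i ∈ S, IsIdempotentElem (e i))
    (hc : ∀ i ∈ S, Commute x (e i)) (h : ∀ i ∈ S, IsDrazinInvertible (x * e i)) :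
    IsDrazinInvertible x := by
  classical
  have h' : ∀ i, ∃ (d : R) (N : ℕ), i ∈ S → (∀ y, Commute (x * e i) y → Commute d y) ∧
      ∀ m, N ≤ m → (x * e i) ^ (m + 1) * d = (x * e i) ^ m := by
    intro i
    by_cases hi : i ∈ S
    · obtain ⟨d, N, h1, -, h2⟩ := (h i hi).exists_bicommutant
      exact ⟨d, N, fun _ => ⟨h1, h2⟩⟩
    · exact ⟨0, 0, fun hi' => absurd hi' hi⟩
  choose d N hdN using h'
  have hcx : ∀ i ∈ S, Commute (x * e i) x := fun i hi => (Commute.refl x).mul_left (hc i hi).symm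
  refine .of_pow_succ_mul_eq (w := ∑ i ∈ S, e i * d i) (m := S.sup N + 1) ?_ ?_
  · exact Commute.sum_right _ _ _ fun i hi =>
      (hc i hi).mul_right ((hdN i hi).1 x (hcx i hi)).symm
  · rw [Finset.mul_sum]
    calc ∑ i ∈ S, x ^ (S.sup N + 1 + 1) * (e i * d i)
        = ∑ i ∈ S, x ^ (S.sup N + 1) * e i := by
          refine Finset.sum_congr rfl fun i hi => ?_
          have := (hdN i hi).2 (S.sup N + 1) ((Finset.le_sup hi).trans (Nat.le_succ _))
          rwa [(hc i hi).mul_pow, (hc i hi).mul_pow, (he i hi).pow_succ_eq, (he i hi).pow_succ_eq,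
            mul_assoc] at this
      _ = x ^ (S.sup N + 1) := by rw [← Finset.mul_sum, hsum, mul_one]

theorem IsUnit.isDrazinInvertible (h : IsUnit x) : IsDrazinInvertible x := by
  obtain ⟨u, rfl⟩ := h
  exact ⟨(↑u⁻¹ : R), 0, by simp, by simp, by simp⟩

theorem isDrazinInvertible_zero : IsDrazinInvertible (0 : R) := ⟨0, 1, by simp⟩

theorem IsDrazinInvertible.smul {𝕜 : Type*} [Field 𝕜] [Algebra 𝕜 R]
    (h : IsDrazinInvertible x) {c : 𝕜} (hc : c ≠ 0) : IsDrazinInvertible (c • x) := by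
  obtain ⟨d, N, hd, -, hN⟩ := h.exists_bicommutant
  refine .of_pow_succ_mul_eq (w := c⁻¹ • d) (m := N)
    (((hd x (Commute.refl x)).symm.smul_left c).smul_right _) ?_
  rw [smul_pow, smul_pow, smul_mul_smul_comm, hN N le_rfl, pow_succ, mul_assoc,
    mul_inv_cancel₀ hc, mul_one]

theorem isDrazinInvertible_smul_iff {𝕜 : Type*} [Field 𝕜] [Algebra 𝕜 R] {c : 𝕜} (hc : c ≠ 0) :
    IsDrazinInvertible (c • x) ↔ IsDrazinInvertible x :=
  ⟨fun h => by simpa [smul_smul, hc] using h.smul (inv_ne_zero hc), fun h => h.smul hc⟩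

end Drazin

/-! ### Spectra consisting of poles -/

open Polynomial in
-- `P(a) - P(z)` is divisible by `z - a`, with a quotient polynomial in `z`.
theorem exists_differentiable_resolvent_mul_aeval {A : Type*} [NormedRing A] [NormedAlgebra ℂ A]
    (a : A) (P : ℂ[X]) : ∃ Q : ℂ → A, Differentiable ℂ Q ∧ ∀ z ∈ resolventSet ℂ a,
      resolvent a z * aeval a P = P.eval z • resolvent a z + Q z := by
  induction P using Polynomial.induction_on with
  | C c =>
    refine ⟨0, differentiable_const _, fun z _ => ?_⟩
    simp [Algebra.smul_def, (Algebra.commutes c (resolvent a z)).symm]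
  | add p q hp hq =>
    obtain ⟨F, hF, hF'⟩ := hp
    obtain ⟨G, hG, hG'⟩ := hq
    refine ⟨F + G, hF.add hG, fun z hz => ?_⟩
    rw [map_add, mul_add, hF' z hz, hG' z hz, eval_add, add_smul, Pi.add_apply]
    abel
  | monomial n c ih =>
    obtain ⟨F, hF, hF'⟩ := ih
    refine ⟨fun z => F z * a - (C c * X ^ n).eval z • 1, ?_, fun z hz => ?_⟩
    · exact (hF.mul_const a).sub ((Polynomial.differentiable _).smul_const _)
    · have hR : resolvent a z * a = z • resolvent a z - 1 := by
        have h1 : resolvent a z * (algebraMap ℂ A z - a) = 1 := Ring.inverse_mul_cancel _ hz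
        rw [mul_sub, ← Algebra.commutes, ← Algebra.smul_def] at h1
        rw [← h1]; abel
      have hs : (C c * X ^ (n + 1) : ℂ[X]) = C c * X ^ n * X := by rw [pow_succ, mul_assoc]
      rw [hs, map_mul, aeval_X, ← mul_assoc, hF' z hz, add_mul, smul_mul_assoc, hR, smul_sub,
        smul_smul, eval_mul_X]
      rw [sub_add_eq_add_sub, add_sub_assoc]

theorem differentiable_extension_of_finite {E : Type*} [NormedAddCommGroup E] [NormedSpace ℂ E]
    {f : ℂ → E} (S : Finset ℂ) (hf : ∀ z ∉ S, DifferentiableAt ℂ f z)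
    (hS : ∀ s ∈ S, ∃ h : ℂ → E, DifferentiableAt ℂ h s ∧ ∀ᶠ z in 𝓝[≠] s, f z = h z) :
    ∃ g : ℂ → E, Differentiable ℂ g ∧ ∀ z ∉ S, g z = f z := by
  classical
  have hS' : ∀ s, ∃ h : ℂ → E, s ∈ S → DifferentiableAt ℂ h s ∧ ∀ᶠ z in 𝓝[≠] s, f z = h z := by
    intro s
    by_cases hs : s ∈ S
    · obtain ⟨h, hh⟩ := hS s hs
      exact ⟨h, fun _ => hh⟩
    · exact ⟨f, fun hs' => absurd hs' hs⟩
  choose h hh using hS'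
  refine ⟨fun z => if z ∈ S then h z z else f z, fun s => ?_, fun z hz => by simp [hz]⟩
  by_cases hs : s ∈ S
  · have hne : ∀ᶠ z in 𝓝[≠] s, z ∉ S := by
      have : ((S.erase s : Finset ℂ) : Set ℂ)ᶜ ∈ 𝓝 s :=
        (S.erase s).finite_toSet.isClosed.isOpen_compl.mem_nhds (by simp)
      filter_upwards [nhdsWithin_le_nhds this, self_mem_nhdsWithin] with z hz hzs hzS
      exact hz (by simpa [hzS] using hzs)
    refine (hh s hs).1.congr_of_eventuallyEq (f := h s) ?_
    have : ∀ᶠ z in 𝓝[≠] s, (if z ∈ S then h z z else f z) = h s z := by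
      filter_upwards [hne, (hh s hs).2] with z h1 h2
      simp [h1, h2]
    rw [eventually_nhdsWithin_iff] at this
    filter_upwards [this] with z hz
    by_cases hzs : z = s
    · subst hzs; simp [hs]
    · exact hz hzs
  · have hne : ∀ᶠ z in 𝓝 s, z ∉ S := S.finite_toSet.isClosed.isOpen_compl.mem_nhds (by simpa)
    refine (hf s hs).congr_of_eventuallyEq ?_
    filter_upwards [hne] with z hz
    simp [hz]

section Poles

variable {A : Type*} [NormedRing A] [NormedAlgebra ℂ A] [CompleteSpace A] {a : A}

theorem finite_spectrum_of_eq_poles (h : spectrum ℂ a = poles a) : (spectrum ℂ a).Finite := by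
  by_contra hinf
  obtain ⟨z, hz, hacc⟩ :=
    Set.Infinite.exists_accPt_of_subset_isCompact hinf (spectrum.isCompact a) subset_rfl
  exact (h.subset hz).1.2 hacc

open Polynomial in
/-- If the spectrum of `a` consists of poles then `a` is algebraic, and it is annihilated by a
polynomial whose roots are the points of the spectrum. -/
theorem exists_aeval_eq_zero_of_eq_poles (h : spectrum ℂ a = poles a) :
    ∃ (S : Finset ℂ) (n : ℂ → ℕ), (S : Set ℂ) = spectrum ℂ a ∧ (∀ s ∈ S, n s ≠ 0) ∧
      aeval a (∏ s ∈ S, (X - C s) ^ n s) = 0 := by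
  classical
  have hfin := finite_spectrum_of_eq_poles h
  set S := hfin.toFinset with hSdef
  have hS : ∀ z, z ∈ S ↔ z ∈ spectrum ℂ a := fun z => by simp [hSdef]
  have hpole : ∀ s, ∃ (p : ℕ) (g : ℂ → A), s ∈ S → 1 ≤ p ∧ AnalyticAt ℂ g s ∧
      ∀ᶠ z in 𝓝[≠] s, resolvent a z = (z - s) ^ (-(p : ℤ)) • g z := by
    intro s
    by_cases hs : s ∈ S
    · obtain ⟨-, hm, p, hp, ho⟩ := h.subset ((hS s).1 hs)
      obtain ⟨g, hg, -, hg'⟩ := (meromorphicOrderAt_eq_int_iff hm).1 ho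
      exact ⟨p, g, fun _ => ⟨hp, hg, hg'⟩⟩
    · exact ⟨0, 0, fun hs' => absurd hs' hs⟩
  choose n g hng using hpole
  refine ⟨S, n, by simp [hSdef], fun s hs => by have := (hng s hs).1; omega, ?_⟩
  set P : ℂ[X] := ∏ s ∈ S, (X - C s) ^ n s with hP
  obtain ⟨Q, hQ, hQ'⟩ := exists_differentiable_resolvent_mul_aeval a P
  have hres : ∀ z, z ∉ S → z ∈ resolventSet ℂ a := fun z hz => by
    by_contra hz'
    exact hz ((hS z).2 hz')
  -- The factor `(z - s) ^ n s` of `P(z)` cancels the pole at `s`, so the singularities are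
  -- removable.
  obtain ⟨G, hG, hGeq⟩ := differentiable_extension_of_finite
      (f := fun z => resolvent a z * aeval a P) S
      (fun z hz => (spectrum.hasDerivAt_resolvent_const_left
        (hres z hz)).differentiableAt.mul_const _) (by
      intro s hs
      obtain ⟨-, hg, hg'⟩ := hng s hs
      obtain ⟨P', hP'⟩ : (X - C s) ^ n s ∣ P := Finset.dvd_prod_of_mem _ hs
      refine ⟨fun z => P'.eval z • g s z + Q z,
        (P'.differentiable s).smul hg.differentiableAt |>.add (hQ s), ?_⟩
      have hne : ∀ᶠ z in 𝓝[≠] s, z ∉ S := by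
        have : ((S.erase s : Finset ℂ) : Set ℂ)ᶜ ∈ 𝓝 s :=
          (S.erase s).finite_toSet.isClosed.isOpen_compl.mem_nhds (by simp)
        filter_upwards [nhdsWithin_le_nhds this, self_mem_nhdsWithin] with z hz hzs hzS
        exact hz (by simpa [hzS] using hzs)
      filter_upwards [hne, hg', self_mem_nhdsWithin] with z hz hgz hzs
      have hzs' : z - s ≠ 0 := sub_ne_zero.2 hzs
      rw [hQ' z (hres z hz), hgz, smul_smul]
      congr 2
      rw [hP']
      simp only [eval_mul, eval_pow, eval_sub, eval_X, eval_C, zpow_neg, zpow_natCast]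
      field_simp)
  have hlim : Filter.Tendsto G (Filter.cocompact ℂ) (𝓝 0) := by
    have h1 : Filter.Tendsto (fun z => resolvent a z * aeval a P) (Filter.cocompact ℂ) (𝓝 0) := by
      rw [← Metric.cobounded_eq_cocompact]
      simpa using (spectrum.resolvent_tendsto_cobounded (𝕜 := ℂ) a).mul_const (aeval a P)
    refine h1.congr' ?_
    filter_upwards [S.finite_toSet.isCompact.compl_mem_cocompact] with z hz
    exact (hGeq z hz).symm
  obtain ⟨z, hz⟩ := Infinite.exists_notMem_finset S
  have hzero : resolvent a z * aeval a P = 0 := by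
    rw [← hGeq z hz]
    exact hG.apply_eq_of_tendsto_cocompact z hlim
  have hu : (algebraMap ℂ A z - a) * resolvent a z = 1 := Ring.mul_inverse_cancel _ (hres z hz)
  rw [← one_mul (aeval a P), ← hu, mul_assoc, hzero, mul_zero]

end Poles

/-! ### Spectral idempotents of an algebraic element -/

section SpectralIdempotents

open Polynomial

variable {A : Type*} [Ring A] [Algebra ℂ A] {a : A} {S : Finset ℂ} {n : ℂ → ℕ}

theorem exists_spectral_idempotents (hS : (S : Set ℂ) = spectrum ℂ a) (hn : ∀ s ∈ S, n s ≠ 0)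
    (h : aeval a (∏ s ∈ S, (X - C s) ^ n s) = 0) :
    ∃ e : ℂ → A, ∑ s ∈ S, e s = 1 ∧ ∀ s ∈ S, IsIdempotentElem (e s) ∧ Commute a (e s) ∧ e s ≠ 0 ∧
      (a - algebraMap ℂ A s) ^ n s * e s = 0 := by
  classical
  rcases S.eq_empty_or_nonempty with rfl | hne
  · exact ⟨0, by simpa using h.symm, by simp⟩
  obtain ⟨μ, hμ⟩ := (exists_sum_eq_one_iff_pairwise_coprime
    (s := fun s : ℂ => (X - C s) ^ n s) hne).2 fun i j hij =>
      (isCoprime_X_sub_C_of_isUnit_sub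
        (sub_ne_zero.2 (fun hh => hij (Subtype.ext hh))).isUnit).pow
  set q : ℂ → ℂ[X] := fun i => μ i * ∏ j ∈ S \ {i}, (X - C j) ^ n j with hq
  have hprod : ∀ i ∈ S, (X - C i) ^ n i * ∏ j ∈ S \ {i}, (X - C j) ^ n j =
      ∏ s ∈ S, (X - C s) ^ n s := fun i hi => by
    rw [Finset.sdiff_singleton_eq_erase, Finset.mul_prod_erase S (fun j => (X - C j) ^ n j) hi]
  have hzero : ∀ p, (∏ s ∈ S, (X - C s) ^ n s) ∣ p → aeval a p = 0 := by
    rintro _ ⟨r, rfl⟩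
    rw [map_mul, h, zero_mul]
  have hsum : ∑ s ∈ S, aeval a (q s) = 1 := by rw [← map_sum, hμ, map_one]
  have horth : ∀ i ∈ S, ∀ j ∈ S, i ≠ j → aeval a (q i) * aeval a (q j) = 0 := by
    intro i hi j hj hij
    rw [← map_mul]
    refine hzero _ ?_
    rw [← hprod i hi, mul_comm]
    exact mul_dvd_mul (Dvd.intro_left _ rfl)
      ((Finset.dvd_prod_of_mem (fun j => (X - C j) ^ n j)
        (Finset.mem_sdiff.2 ⟨hi, by simpa using hij⟩)).mul_left _)
  refine ⟨fun s => aeval a (q s), hsum, fun s hs => ⟨?_, ?_, ?_, ?_⟩⟩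
  · calc aeval a (q s) * aeval a (q s) = ∑ t ∈ S, aeval a (q s) * aeval a (q t) :=
          (Finset.sum_eq_single_of_mem s hs fun t ht hts => horth s hs t ht hts.symm).symm
      _ = aeval a (q s) := by rw [← Finset.mul_sum, hsum, mul_one]
  · simpa using (Commute.all (X : ℂ[X]) (q s)).map (aeval a)
  -- If `q s` vanished at `a`, the other `q t`, all divisible by `X - s`, would sum to `1` at `a`,
  -- making `a - s` invertible.
  · intro h0
    have hdvd : (X - C s) ∣ ∑ t ∈ S.erase s, q t := by
      refine Finset.dvd_sum fun t ht => ?_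
      obtain ⟨hts, htS⟩ := Finset.mem_erase.1 ht
      refine Dvd.dvd.mul_left ?_ _
      exact (dvd_pow_self _ (hn s hs)).trans (Finset.dvd_prod_of_mem (fun j => (X - C j) ^ n j)
        (Finset.mem_sdiff.2 ⟨hs, by simpa using hts.symm⟩))
    have h1 : aeval a (∑ t ∈ S.erase s, q t) = 1 := by
      rw [map_sum, ← hsum, ← Finset.add_sum_erase S _ hs]
      simp only at h0 ⊢
      rw [h0, zero_add]
    obtain ⟨r, hr⟩ := hdvd
    have hr1 : (a - algebraMap ℂ A s) * aeval a r = 1 := by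
      rw [← h1, hr, map_mul, map_sub, aeval_X, aeval_C]
    have hr2 : aeval a r * (a - algebraMap ℂ A s) = 1 := by
      rw [← h1, hr, mul_comm, map_mul, map_sub, aeval_X, aeval_C]
    have hu : IsUnit (a - algebraMap ℂ A s) := ⟨⟨_, _, hr1, hr2⟩, rfl⟩
    have hmem : s ∈ spectrum ℂ a := hS ▸ hs
    rw [spectrum.mem_iff, ← IsUnit.neg_iff, neg_sub] at hmem
    exact hmem hu
  · have : (a - algebraMap ℂ A s) ^ n s * aeval a (q s) = aeval a ((X - C s) ^ n s * q s) := by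
      simp
    rw [this]
    refine hzero _ ?_
    rw [← hprod s hs]
    exact mul_dvd_mul_left _ (Dvd.intro_left _ rfl)

end SpectralIdempotents

/-! ### Slice maps and the Drazin spectrum of a product -/

section Slices

variable {A B D : Type*} [Ring A] [Algebra ℂ A] [Ring B] [Algebra ℂ B] [Ring D] [Algebra ℂ D]

theorem IsDrazinInvertible.map {R R' : Type*} [Ring R] [Ring R'] (f : R →+* R') {x : R}
    (h : IsDrazinInvertible x) : IsDrazinInvertible (f x) := by
  obtain ⟨d, m, h1, h2, h3⟩ := h
  exact ⟨f d, m, by rw [← map_pow, ← map_mul, ← map_mul, h1], by rw [← map_mul, ← map_mul, h2],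
    by rw [← map_mul, ← map_mul, h3]⟩

/-- Slice maps at the nonzero elements of `A`, for a pair of commuting representations of `A` and
`B` in `D`: for every `e ≠ 0` there is a `B`-bimodule map `D → B` sending `e` to `1`. -/
def HasSlices (i : A →ₐ[ℂ] D) (j : B →ₐ[ℂ] D) : Prop :=
  ∀ e : A, e ≠ 0 → ∃ E : D → B, E (i e) = 1 ∧ (∀ y u, E (j y * u) = y * E u) ∧
    ∀ y u, E (u * j y) = E u * y

variable {i : A →ₐ[ℂ] D} {j : B →ₐ[ℂ] D}

theorem isDrazinInvertible_map_mul_map_iff (hc : ∀ x y, Commute (i x) (j y)) (hE : HasSlices i j)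
    {e : A} (he : IsIdempotentElem e) (he0 : e ≠ 0) (x : B) :
    IsDrazinInvertible (j x * i e) ↔ IsDrazinInvertible x := by
  have hie : IsIdempotentElem (i e) := he.map i
  refine ⟨fun h => ?_, fun h => (h.map (j : B →+* D)).mul_idempotent hie (hc e x).symm⟩
  obtain ⟨d, N, hd, -, hN⟩ := h.exists_bicommutant
  obtain ⟨E, hE1, hEl, hEr⟩ := hE e he0
  have hde : Commute d (i e) := hd _ ((hc e x).symm.mul_left (Commute.refl _))
  have hdx : Commute d (j x) := hd _ ((Commute.refl _).mul_left (hc e x))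
  -- The bimodule property of `E` carries the equations for `d` down to `B`.
  refine .of_pow_succ_mul_eq (w := E (i e * d)) (m := N + 1) ?_ ?_
  · rw [Commute, SemiconjBy, ← hEl, ← hEr, ((hc e x).mul_left hdx).eq]
  · have h1 := hN (N + 1) (Nat.le_succ N)
    rw [(hc e x).symm.mul_pow, (hc e x).symm.mul_pow, hie.pow_succ_eq, hie.pow_succ_eq,
      ← map_pow, ← map_pow, mul_assoc] at h1
    rw [← hEl, h1, hEl, hE1, mul_one]

open Polynomial in
theorem drazinSpectrum_map_mul_map (hc : ∀ x y, Commute (i x) (j y)) (hE : HasSlices i j)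
    {a : A} (b : B) {S : Finset ℂ} {n : ℂ → ℕ} (hS : (S : Set ℂ) = spectrum ℂ a)
    (hn : ∀ s ∈ S, n s ≠ 0) (h : aeval a (∏ s ∈ S, (X - C s) ^ n s) = 0) :
    drazinSpectrum (i a * j b) = ⋃ s ∈ spectrum ℂ a, drazinSpectrum (s • b) := by
  obtain ⟨e, hsum, he⟩ := exists_spectral_idempotents hS hn h
  ext z
  simp only [drazinSpectrum, Set.mem_ofPred_eq, Set.mem_iUnion, exists_prop, ← hS,
    Finset.mem_coe]
  rw [← not_iff_not]
  push Not
  set x := i a * j b - algebraMap ℂ D z with hx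
  have hxe : ∀ s ∈ S, Commute x (i (e s)) := fun s hs =>
    (((he s hs).2.1.map i).mul_left (hc _ _).symm).sub_left (Algebra.commutes _ _)
  have key : ∀ s ∈ S, IsDrazinInvertible (x * i (e s)) ↔
      IsDrazinInvertible (s • b - algebraMap ℂ B z) := by
    intro s hs
    obtain ⟨hid, hae, he0, hnil⟩ := he s hs
    rw [← isDrazinInvertible_map_mul_map_iff hc hE hid he0]
    set y := j (s • b - algebraMap ℂ B z) * i (e s) with hy
    set N := i ((a - algebraMap ℂ A s) * e s) * j b with hN
    have hase : Commute (a - algebraMap ℂ A s) (e s) := hae.sub_left (Algebra.commutes _ _)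
    have hNn : IsNilpotent N := by
      refine (hc _ _).isNilpotent_mul_right ⟨n s, ?_⟩
      obtain ⟨k, hk⟩ := Nat.exists_eq_succ_of_ne_zero (hn s hs)
      rw [← map_pow, hase.mul_pow]
      nth_rewrite 2 [hk]
      rw [hid.pow_succ_eq, hnil, map_zero]
    have hyN : Commute y N := by
      have h1 : Commute (i (e s)) N :=
        ((hase.symm.mul_right (Commute.refl _)).map i).mul_right (hc _ _)
      have h2 : Commute (j (s • b - algebraMap ℂ B z)) N := by
        refine (hc _ _).symm.mul_right (Commute.map ?_ j)
        exact ((Commute.refl b).smul_left s).sub_left (Algebra.commutes _ _)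
      exact h2.mul_left h1
    have hxy : x * i (e s) = y + N := by
      have hb : i (e s) * j b = j b * i (e s) := (hc _ _).eq
      simp only [hx, hy, hN, map_sub, map_mul, map_smul, sub_mul, smul_mul_assoc,
        mul_assoc, Algebra.algebraMap_eq_smul_one, hb, map_one, one_mul]
      abel
    rw [hxy]
    refine ⟨fun h => ?_, fun h => h.add_nilpotent hNn hyN⟩
    simpa using h.add_nilpotent hNn.neg (hyN.neg_right.add_left (Commute.refl N).neg_right)
  refine ⟨fun hd s hs => ?_, fun hd => ?_⟩
  · exact (key s hs).1 (hd.mul_idempotent ((he s hs).1.map i) (hxe s hs))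
  · exact isDrazinInvertible_of_forall_mul_idempotent S (fun s => i (e s))
      (by rw [← map_sum, hsum, map_one]) (fun s hs => (he s hs).1.map i) hxe
      fun s hs => (key s hs).2 (hd s hs)

open Polynomial in
-- The product formula applies with second factor `1 ∈ ℂ`, scaled linear functionals serving as
-- slices; every element of `ℂ` is zero or a unit.
theorem drazinSpectrum_eq_empty_of_aeval_eq_zero
    {a : A} {S : Finset ℂ} {n : ℂ → ℕ} (hS : (S : Set ℂ) = spectrum ℂ a)
    (hn : ∀ s ∈ S, n s ≠ 0) (h : aeval a (∏ s ∈ S, (X - C s) ^ n s) = 0) :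
    drazinSpectrum a = ∅ := by
  have hslices : HasSlices (AlgHom.id ℂ A) (Algebra.ofId ℂ A) := by
    intro e he
    obtain ⟨f, hf⟩ : ∃ f : Module.Dual ℂ A, f e ≠ 0 := by
      by_contra! hf
      exact he ((Module.forall_dual_apply_eq_zero_iff ℂ e).1 hf)
    refine ⟨⇑((f e)⁻¹ • f), by simp [hf], fun y u => ?_, fun y u => ?_⟩
    · rw [Algebra.ofId_apply, ← Algebra.smul_def, map_smul, smul_eq_mul]
    · rw [Algebra.ofId_apply, ← Algebra.commutes, ← Algebra.smul_def, map_smul, smul_eq_mul,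
        mul_comm]
  have hd := drazinSpectrum_map_mul_map (i := AlgHom.id ℂ A) (j := Algebra.ofId ℂ A)
    (fun x y => (Algebra.commutes y x).symm) hslices 1 hS hn h
  rw [map_one, mul_one, AlgHom.id_apply] at hd
  rw [hd]
  refine Set.eq_empty_of_forall_notMem fun z hz => ?_
  obtain ⟨s, -, hs⟩ := Set.mem_iUnion₂.1 hz
  refine hs ?_
  rcases eq_or_ne (s • (1 : ℂ) - algebraMap ℂ ℂ z) 0 with h0 | h0
  · exact h0 ▸ isDrazinInvertible_zero
  · exact (IsUnit.mk0 _ h0).isDrazinInvertible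

theorem drazinSpectrum_smul {s : ℂ} (hs : s ≠ 0) (b : B) :
    drazinSpectrum (s • b) = s • drazinSpectrum b := by
  ext z
  rw [Set.mem_smul_set_iff_inv_smul_mem₀ hs, drazinSpectrum, drazinSpectrum, Set.mem_ofPred_eq,
    Set.mem_ofPred_eq, ← isDrazinInvertible_smul_iff (inv_ne_zero hs), smul_sub, smul_smul,
    inv_mul_cancel₀ hs, one_smul, smul_eq_mul, map_mul, ← Algebra.smul_def]

theorem drazinSpectrum_zero : drazinSpectrum (0 : B) = ∅ := by
  refine Set.eq_empty_of_forall_notMem fun z hz => hz ?_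
  rcases eq_or_ne z 0 with rfl | hz0
  · simpa using isDrazinInvertible_zero
  · rw [zero_sub]
    exact ((IsUnit.mk0 z hz0).map (algebraMap ℂ B)).neg.isDrazinInvertible

end Slices

theorem drazinSpectrum_map_mul_map_eq_drazinProductSet_iff {A B D : Type*} [NormedRing A]
    [NormedAlgebra ℂ A] [CompleteSpace A] [Ring B] [Algebra ℂ B] [Ring D] [Algebra ℂ D]
    {i : A →ₐ[ℂ] D} {j : B →ₐ[ℂ] D} (hc : ∀ x y, Commute (i x) (j y)) (hE : HasSlices i j)
    {a : A} {b : B} (ha : spectrum ℂ a = poles a) (ha0 : poles a ≠ {0})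
    (hb : (drazinSpectrum b).Nonempty) :
    drazinSpectrum (i a * j b) = drazinProductSet a b ↔
      0 ∉ poles a ∨ 0 ∉ drazinResolventSet b := by
  obtain ⟨S, n, hS, hn, hP⟩ := exists_aeval_eq_zero_of_eq_poles ha
  have hres : 0 ∉ drazinResolventSet b ↔ 0 ∈ drazinSpectrum b := Iff.rfl
  rw [drazinSpectrum_map_mul_map hc hE b hS hn hP, drazinProductSet,
    drazinSpectrum_eq_empty_of_aeval_eq_zero hS hn hP, Set.empty_mul, Set.union_empty, hres, ← ha]
  have hmem : ∀ {s z : ℂ}, s ≠ 0 → (z ∈ drazinSpectrum (s • b) ↔ ∃ w ∈ drazinSpectrum b,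
      s * w = z) := fun hs => by rw [drazinSpectrum_smul hs]; exact Set.mem_smul_set
  constructor
  · intro h
    by_contra! hcon
    obtain ⟨h0, hb0⟩ := hcon
    obtain ⟨w, hw⟩ := hb
    have hz : (0 : ℂ) ∈ spectrum ℂ a * drazinSpectrum b :=
      Set.mem_mul.2 ⟨0, h0, w, hw, zero_mul w⟩
    rw [← h] at hz
    obtain ⟨s, -, hs⟩ := Set.mem_iUnion₂.1 hz
    rcases eq_or_ne s 0 with rfl | hs0
    · rw [zero_smul, drazinSpectrum_zero] at hs
      exact hs
    · obtain ⟨v, hv, hv0⟩ := (hmem hs0).1 hs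
      rcases mul_eq_zero.1 hv0 with h1 | rfl
      · exact hs0 h1
      · exact hb0 hv
  · intro h
    ext z
    rw [Set.mem_iUnion₂, Set.mem_mul]
    constructor
    · rintro ⟨s, hs, hz⟩
      rcases eq_or_ne s 0 with rfl | hs0
      · rw [zero_smul, drazinSpectrum_zero] at hz
        exact hz.elim
      · exact ⟨s, hs, (hmem hs0).1 hz⟩
    · rintro ⟨s, hs, w, hw, rfl⟩
      rcases eq_or_ne s 0 with rfl | hs0
      · have hb0 : 0 ∈ drazinSpectrum b := h.resolve_left (not_not_intro hs)
        -- The product `0 * w` is recovered as `t * 0` with `t ≠ 0`; this is where `Π(a) ≠ {0}`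
        -- enters.
        obtain ⟨t, ht, ht0⟩ : ∃ t ∈ spectrum ℂ a, t ≠ 0 := by
          by_contra! hcon
          exact ha0 (ha ▸ Set.eq_singleton_iff_unique_mem.2 ⟨hs, hcon⟩)
        exact ⟨t, ht, (hmem ht0).2 ⟨0, hb0, by simp⟩⟩
      · exact ⟨s, hs, (hmem hs0).2 ⟨w, hw, rfl⟩⟩

/-! ### Slice maps on the completed tensor product -/

noncomputable section

namespace UniformCrossnorm

variable {A B : Type*} [NormedRing A] [NormedAlgebra ℂ A] [NormedRing B] [NormedAlgebra ℂ B]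
  (α : UniformCrossnorm A B)

/-- The inclusion of `A ⊗ B` in its completion. -/
def coeAlgHom : A ⊗[ℂ] B →ₐ[ℂ] α.BanachTensor where
  __ := (UniformSpace.Completion.coeRingHom : α.AlgTensor →+* α.BanachTensor).comp
    (α.ofTensor : A ⊗[ℂ] B →+* α.AlgTensor)
  commutes' _ := rfl

theorem coeAlgHom_tmul (a : A) (b : B) : α.coeAlgHom (a ⊗ₜ[ℂ] b) = α.tmul a b := rfl

/-- The embedding `x ↦ x ⊗ 1`. -/
def inclLeft : A →ₐ[ℂ] α.BanachTensor := α.coeAlgHom.comp Algebra.TensorProduct.includeLeft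

/-- The embedding `y ↦ 1 ⊗ y`. -/
def inclRight : B →ₐ[ℂ] α.BanachTensor := α.coeAlgHom.comp Algebra.TensorProduct.includeRight

theorem inclLeft_mul_inclRight (a : A) (b : B) : α.inclLeft a * α.inclRight b = α.tmul a b := by
  rw [inclLeft, inclRight, AlgHom.comp_apply, AlgHom.comp_apply, ← map_mul, ← coeAlgHom_tmul]
  simp

theorem commute_inclLeft_inclRight (a : A) (b : B) : Commute (α.inclLeft a) (α.inclRight b) := by
  have h : Commute (a ⊗ₜ[ℂ] (1 : B)) ((1 : A) ⊗ₜ[ℂ] b) := by simp [Commute, SemiconjBy]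
  exact h.map α.coeAlgHom

/-- A bounded bimodule map on `A ⊗ B` extends to the completion. -/
theorem exists_bimodule_extension {F : Type*} [NormedRing F] [NormedAlgebra ℂ F] [CompleteSpace F]
    (j : F →ₐ[ℂ] A ⊗[ℂ] B) (L : A ⊗[ℂ] B →ₗ[ℂ] F) (K : ℝ) (hK : ∀ u, ‖L u‖ ≤ K * α.toFun u)
    (hl : ∀ y u, L (j y * u) = y * L u) (hr : ∀ y u, L (u * j y) = L u * y) :
    ∃ E : α.BanachTensor → F, (∀ u, E (α.coeAlgHom u) = L u) ∧
      (∀ y u, E (α.coeAlgHom (j y) * u) = y * E u) ∧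
      ∀ y u, E (u * α.coeAlgHom (j y)) = E u * y := by
  let L' : α.AlgTensor →L[ℂ] F :=
    LinearMap.mkContinuous (L ∘ₗ (α.ofTensor.symm : α.AlgTensor →ₗ[ℂ] A ⊗[ℂ] B)) K hK
  have hu : UniformContinuous L' := L'.uniformContinuous
  have hcont : Continuous (UniformSpace.Completion.extension L') :=
    UniformSpace.Completion.continuous_extension
  have hcoe : ∀ u, UniformSpace.Completion.extension L' (α.coeAlgHom u) = L u := fun u =>
    UniformSpace.Completion.extension_coe hu (α.ofTensor u)
  have hEl : ∀ y v, UniformSpace.Completion.extension L' (α.coeAlgHom (j y) * α.coeAlgHom v) =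
      y * UniformSpace.Completion.extension L' (α.coeAlgHom v) := fun y v => by
    rw [← map_mul, hcoe, hcoe, hl]
  have hEr : ∀ y v, UniformSpace.Completion.extension L' (α.coeAlgHom v * α.coeAlgHom (j y)) =
      UniformSpace.Completion.extension L' (α.coeAlgHom v) * y := fun y v => by
    rw [← map_mul, hcoe, hcoe, hr]
  refine ⟨UniformSpace.Completion.extension L', hcoe, fun y u => ?_, fun y u => ?_⟩
  · refine UniformSpace.Completion.induction_on u
      (isClosed_eq (hcont.comp (continuous_const_mul _)) (hcont.const_mul y)) fun v => ?_
    exact hEl y (α.ofTensor.symm v)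
  · refine UniformSpace.Completion.induction_on u
      (isClosed_eq (hcont.comp (continuous_mul_const _)) (hcont.mul_const y)) fun v => ?_
    exact hEr y (α.ofTensor.symm v)

/-- The slice is `L = f ⊗ id` with `f e = 1`. Uniformity for the rank-one operator `f(·) e` bounds
`e ⊗ L u`, whose norm is `‖e‖ ‖L u‖`, so `L` extends continuously. -/
theorem hasSlices_inclLeft_inclRight [CompleteSpace B] : HasSlices α.inclLeft α.inclRight := by
  intro e he
  obtain ⟨f, hf⟩ := SeparatingDual.exists_eq_one (R := ℂ) he
  have he' : 0 < ‖e‖ := norm_pos_iff.2 he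
  let L : A ⊗[ℂ] B →ₗ[ℂ] B :=
    (TensorProduct.lid ℂ B : ℂ ⊗[ℂ] B →ₗ[ℂ] B) ∘ₗ (f : A →ₗ[ℂ] ℂ).rTensor B
  have hL : ∀ x y, L (x ⊗ₜ y) = f x • y := fun x y => by simp [L]
  have hmap : ∀ u, TensorProduct.map ((f.smulRight e : A →L[ℂ] A) : A →ₗ[ℂ] A)
      ((ContinuousLinearMap.id ℂ B : B →L[ℂ] B) : B →ₗ[ℂ] B) u = e ⊗ₜ[ℂ] L u := fun u => by
    induction u using TensorProduct.induction_on with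
    | zero => simp
    | tmul x y => simp [hL, TensorProduct.smul_tmul]
    | add u v hu hv => rw [map_add, map_add, hu, hv, TensorProduct.tmul_add]
  obtain ⟨E, hE, hEl, hEr⟩ := α.exists_bimodule_extension Algebra.TensorProduct.includeRight L
    (‖f.smulRight e‖ * ‖ContinuousLinearMap.id ℂ B‖ / ‖e‖) (fun u => by
      have h := α.map_map_le' (f.smulRight e) (ContinuousLinearMap.id ℂ B) u
      rw [hmap, α.map_tmul'] at h
      rw [div_mul_eq_mul_div, le_div_iff₀ he', mul_comm]
      exact h)
    (fun y u => by
      induction u using TensorProduct.induction_on with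
      | zero => simp
      | tmul x z => simp [hL]
      | add u v hu hv => rw [mul_add, map_add, map_add, hu, hv, mul_add])
    (fun y u => by
      induction u using TensorProduct.induction_on with
      | zero => simp
      | tmul x z => simp [hL]
      | add u v hu hv => rw [add_mul, map_add, map_add, hu, hv, add_mul])
  exact ⟨E, (hE _).trans (by simp [hL, hf]), hEl, hEr⟩

theorem hasSlices_inclRight_inclLeft [CompleteSpace A] : HasSlices α.inclRight α.inclLeft := by
  intro e he
  obtain ⟨f, hf⟩ := SeparatingDual.exists_eq_one (R := ℂ) he
  have he' : 0 < ‖e‖ := norm_pos_iff.2 he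
  let L : A ⊗[ℂ] B →ₗ[ℂ] A :=
    (TensorProduct.rid ℂ A : A ⊗[ℂ] ℂ →ₗ[ℂ] A) ∘ₗ (f : B →ₗ[ℂ] ℂ).lTensor A
  have hL : ∀ x y, L (x ⊗ₜ y) = f y • x := fun x y => by simp [L]
  have hmap : ∀ u, TensorProduct.map ((ContinuousLinearMap.id ℂ A : A →L[ℂ] A) : A →ₗ[ℂ] A)
      ((f.smulRight e : B →L[ℂ] B) : B →ₗ[ℂ] B) u = L u ⊗ₜ[ℂ] e := fun u => by
    induction u using TensorProduct.induction_on with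
    | zero => simp
    | tmul x y => simp [hL, TensorProduct.smul_tmul]
    | add u v hu hv => rw [map_add, map_add, hu, hv, TensorProduct.add_tmul]
  obtain ⟨E, hE, hEl, hEr⟩ := α.exists_bimodule_extension Algebra.TensorProduct.includeLeft L
    (‖ContinuousLinearMap.id ℂ A‖ * ‖f.smulRight e‖ / ‖e‖) (fun u => by
      have h := α.map_map_le' (ContinuousLinearMap.id ℂ A) (f.smulRight e) u
      rw [hmap, α.map_tmul'] at h
      rw [div_mul_eq_mul_div, le_div_iff₀ he']
      exact h)
    (fun y u => by
      induction u using TensorProduct.induction_on with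
      | zero => simp
      | tmul x z => simp [hL]
      | add u v hu hv => rw [mul_add, map_add, map_add, hu, hv, mul_add])
    (fun y u => by
      induction u using TensorProduct.induction_on with
      | zero => simp
      | tmul x z => simp [hL]
      | add u v hu hv => rw [add_mul, map_add, map_add, hu, hv, add_mul])
  exact ⟨E, (hE _).trans ((hL 1 e).trans (by simp [hf])), hEl, hEr⟩

end UniformCrossnorm

end

theorem drazinProductSet_comm {A B : Type*} [Ring A] [Algebra ℂ A] [Ring B] [Algebra ℂ B]
    (a : A) (b : B) : drazinProductSet a b = drazinProductSet b a := by
  rw [drazinProductSet, drazinProductSet, Set.union_comm, mul_comm, mul_comm (spectrum ℂ a)]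

theorem theorem4p2 {A B : Type*} [NormedRing A] [NormedAlgebra ℂ A] [CompleteSpace A]
    [NormedRing B] [NormedAlgebra ℂ B] [CompleteSpace B]
    (α : UniformCrossnorm A B) (a : A) (b : B) :
    (spectrum ℂ a = poles a → poles a ≠ {0} → (drazinSpectrum b).Nonempty →
      (drazinSpectrum (α.tmul a b) = drazinProductSet a b ↔
        0 ∉ poles a ∨ 0 ∉ drazinResolventSet b)) ∧
    ((drazinSpectrum a).Nonempty → spectrum ℂ b = poles b → poles b ≠ {0} →
      (drazinSpectrum (α.tmul a b) = drazinProductSet a b ↔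
        0 ∉ drazinResolventSet a ∨ 0 ∉ poles b)) := by
  refine ⟨fun ha ha0 hb => ?_, fun ha hb hb0 => ?_⟩
  · rw [← α.inclLeft_mul_inclRight]
    exact drazinSpectrum_map_mul_map_eq_drazinProductSet_iff α.commute_inclLeft_inclRight
      α.hasSlices_inclLeft_inclRight ha ha0 hb
  · rw [← α.inclLeft_mul_inclRight, (α.commute_inclLeft_inclRight a b).eq, drazinProductSet_comm,
      or_comm]
    exact drazinSpectrum_map_mul_map_eq_drazinProductSet_iff
      (fun x y => (α.commute_inclLeft_inclRight y x).symm) α.hasSlices_inclRight_inclLeft hb hb0 ha
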